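/- Let $\mathrm{L}=\mathcal R\cup\mathcal D$ be a relational $\omega$-signature ($\mathcal R$ a set of relation symbols of finite arity, $\mathcal D$ a set of constants) and $\mathcal C$ an infinite set of constants disjoint from $\mathrm{L}$; $\mathrm{L}(\mathcal C)$ is $\mathrm{L}$ with the constants of $\mathcal C$ added. $\mathrm{L}(\mathcal C)_{\infty\infty}$-formulae are built from atomic formulae by $\neg$, $\bigwedge\Phi$ and $\bigvee\Phi$ ($\Phi$ any set of formulae), and $\forall\vec v$, $\exists\vec v$ ($\vec v$ any set-sized string of variables); in $\mathrm{L}(\mathcal C)_{\infty\omega}$-sentences all strings $\vec v$ are finite. Let $\phi\neg$ be: $\neg\phi$ for $\phi$ atomic; $\varphi$ for $\phi=\neg\varphi$; and $\bigvee\{\neg\varphi:\varphi\in\Phi\}$, $\bigwedge\{\neg\varphi:\varphi\in\Phi\}$, $\exists\vec v\,\neg\varphi$, $\forall\vec v\,\neg\varphi$ for $\phi=\bigwedge\Phi$, $\bigvee\Phi$, $\forall\vec v\,\varphi$, $\exists\vec v\,\varphi$ respectively. A set $S$ of sets of sentences is a consistency property if for all $s\in S$: (Con) for no $\phi$ are both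 $\phi,\neg\phi\in s$; (Ind.1) if $\neg\phi\in s$, then $s\cup\{\phi\neg\}\in S$; (Ind.2) if $\bigwedge\Phi\in s$, then $s\cup\{\phi\}\in S$ for all $\phi\in\Phi$; (Ind.3) if $\forall\vec v\,\phi(\vec v)\in s$, then $s\cup\{\phi(\vec c)\}\in S$ for all $\vec c\in(\mathcal C\cup\mathcal D)^{|\vec v|}$; (Ind.4) if $\bigvee\Phi\in s$, then $s\cup\{\phi\}\in S$ for some $\phi\in\Phi$; (Ind.5) if $\exists\vec v\,\phi(\vec v)\in s$, then $s\cup\{\phi(\vec c)\}\in S$ for some $\vec c\in\mathcal C^{|\vec v|}$; (Str.1) if $c,d\in\mathcal C\cup\mathcal D$ and $(c=d)\in s$, then $s\cup\{d=c\}\in S$; (Str.2) if $c,d\in\mathcal C\cup\mathcal D$ and $\{c=d,\phi(d)\}\subseteq s$, then $s\cup\{\phi(c)\}\in S$; (Str.3) if $d\in\mathcal C\cup\mathcal D$, then $s\cup\{c=d\}\in S$ for some $c\in\mathcal C$. The forcing notion $\mathbb P_S$ consists of all subsets of elements of $S$, ordered by reverse inclusion. For a filter $F$ on $\mathbb P_S$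 let $\Sigma_F=\bigcup F$, and let the term model $\mathcal A_F$ have as domain the set of the classes $[c]_F=\{d\in\mathcal C\cup\mathcal D:(c=d)\in\Sigma_F\}$, $c\in\mathcal C\cup\mathcal D$; a constant $c$ is interpreted by $[c]_F$, and $R([c_1]_F,\dots,[c_n]_F)$ holds iff $R(c_1,\dots,c_n)\in\Sigma_F$. **Theorem.** Let $S$ be a consistency property consisting of sets of $\mathrm{L}(\mathcal C)_{\infty\omega}$-sentences, and let $F$ be a $V$-generic filter for $\mathbb P_S$. Then the following holds in $V[F]$ (that is, it has Boolean value $1$ in the Boolean valued universe $V^{\mathrm{RO}(\mathbb P_S)}$ over the complete Boolean algebra of regular open subsets of $\mathbb P_S$, with $F$ the canonical generic filter): 1. $\mathcal A_F$ is a well defined $\mathrm{L}(\mathcal C)$-structure: $[c]_F=[d]_F$ iff $(c=d)\in\Sigma_F$, and whether $R([c_1]_F,\dots,[c_n]_F)$ holds does not depend on the chosen representatives; 2. the domain of $\mathcal A_F$ is exactly $\{[c]_F:c\in\mathcal C\}$; 3. for every $\mathrm{L}(\mathcal C)_{\infty\omega}$-sentence $\psi$, if $\psi\in\Sigma_F$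 then $\mathcal A_F\models\psi$. **Corollary.** For every $s\in S$, $s\not\vdash\emptyset$. Here $\vdash$ is derivability in the infinitary sequent calculus on sequents $\Gamma\vdash\Delta$ of sets of $\mathrm{L}(\mathcal C)_{\infty\infty}$-formulae, whose rules and axioms are: $\Gamma,\phi\vdash\phi,\Delta$; cut; substitution of variables for variables; weakening; the left and right rules for $\neg$; from $\Gamma,\Gamma'\vdash\Delta$ infer $\Gamma,\bigwedge\Gamma'\vdash\Delta$; from $\Gamma\vdash\phi_i,\Delta$ for all $i\in I$ infer $\Gamma\vdash\bigwedge_{i\in I}\phi_i,\Delta$; from $\Gamma,\phi(\vec t)\vdash\Delta$ infer $\Gamma,\forall\vec v\,\phi(\vec v)\vdash\Delta$ ($\vec t$ any string of terms); from $\Gamma\vdash\phi(\vec w),\Delta$ infer $\Gamma\vdash\forall\vec v\,\phi(\vec v),\Delta$ ($\vec w$ a string of distinct variables not free in $\Gamma\cup\Delta\cup\{\phi\}$); $v=w\vdash w=v$ for variables $v,w$; $\vec u=\vec t,\ \phi(\vec t)\vdash\phi(\vec u)$; and $\bigvee$, $\exists$ are treated as abbreviations of $\neg\bigwedge\neg$,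 $\neg\forall\neg$ (both directions of these equivalences are axioms). -/

import Mathlib

universe u w

noncomputable section

namespace InfLogic

/-! ## Syntax of the infinitary logic -/

/-- A relational first order signature: relation symbols of finite arity and constant symbols. -/
structure Signature : Type (u + 1) where
  Rel : ℕ → Type u
  Const : Type u

/-- `L.adjoin C` is the signature `L(C)`: the elements of `C` are added as fresh constants. -/
def Signature.adjoin (L : Signature.{u}) (C : Type u) : Signature.{u} where
  Rel := L.Rel
  Const := L.Const ⊕ C

/-- Terms with variables from `V`: variables (`Sum.inl`) and constants (`Sum.inr`). -/
abbrev Signature.Term (T : Signature.{u}) (V : Type u) : Type u := V ⊕ T.Const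

/-- Formulae of the logic `T_{∞∞}` with free variables from `V`. Conjunctions and disjunctions are
taken over arbitrary set-indexed families; a quantifier binds simultaneously a string of new
variables indexed by an arbitrary set `W`. -/
inductive Fml (T : Signature.{u}) : Type u → Type (u + 1)
  | eq {V : Type u} (t s : T.Term V) : Fml T V
  | rel {V : Type u} {n : ℕ} (R : T.Rel n) (t : Fin n → T.Term V) : Fml T V
  | neg {V : Type u} (φ : Fml T V) : Fml T V
  | conj {V ι : Type u} (φ : ι → Fml T V) : Fml T V
  | disj {V ι : Type u} (φ : ι → Fml T V) : Fml T V
  | all {V : Type u} (W : Type u) (φ : Fml T (V ⊕ W)) : Fml T V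
  | ex {V : Type u} (W : Type u) (φ : Fml T (V ⊕ W)) : Fml T V

/-- Sentences of `T_{∞∞}`. -/
abbrev Sentence (T : Signature.{u}) : Type (u + 1) := Fml T PEmpty.{u + 1}

namespace Fml

variable {T : Signature.{u}}

/-- Every quantifier occurring in the formula binds a finite string of variables. The sentences
with this property are exactly the `T_{∞ω}`-sentences (the requirement that a conjunction or
disjunction has only finitely many free variables is automatic inside a sentence). -/
def IsFinitary : {V : Type u} → Fml T V → Prop
  | _, eq _ _ => True
  | _, rel _ _ => True
  | _, neg φ => φ.IsFinitary
  | _, conj φ => ∀ i, (φ i).IsFinitary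
  | _, disj φ => ∀ i, (φ i).IsFinitary
  | _, all W φ => Finite W ∧ φ.IsFinitary
  | _, ex W φ => Finite W ∧ φ.IsFinitary

/-- The value of a substitution at a term. -/
def substTerm {V V' : Type u} (σ : V → T.Term V') : T.Term V → T.Term V' :=
  Sum.elim σ Sum.inr

/-- A substitution under a quantifier: the bound variables are left unchanged. -/
def liftSubst {V V' : Type u} (W : Type u) (σ : V → T.Term V') : V ⊕ W → T.Term (V' ⊕ W) :=
  Sum.elim (fun v => Sum.map Sum.inl id (σ v)) (fun x => Sum.inl (Sum.inr x))

/-- Simultaneous (capture avoiding) substitution of terms for the free variables. -/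
def subst : {V V' : Type u} → Fml T V → (V → T.Term V') → Fml T V'
  | _, _, eq t s, σ => eq (substTerm σ t) (substTerm σ s)
  | _, _, rel R t, σ => rel R (fun i => substTerm σ (t i))
  | _, _, neg φ, σ => neg (φ.subst σ)
  | _, _, conj φ, σ => conj (fun i => (φ i).subst σ)
  | _, _, disj φ, σ => disj (fun i => (φ i).subst σ)
  | _, _, all W φ, σ => all W (φ.subst (liftSubst W σ))
  | _, _, ex W φ, σ => ex W (φ.subst (liftSubst W σ))

/-- `φ(t)`: the variables from `W` are replaced by the terms `t`, those from `V` are kept. -/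
def inst {V W : Type u} (φ : Fml T (V ⊕ W)) (t : W → T.Term V) : Fml T V :=
  φ.subst (Sum.elim Sum.inl t)

/-- `φ(c)` for a string `c` of constants. -/
def instConst {V W : Type u} (φ : Fml T (V ⊕ W)) (c : W → T.Const) : Fml T V :=
  φ.inst (fun x => Sum.inr (c x))

/-- The variable `v` occurs free in the formula. -/
def OccursFree : {V : Type u} → V → Fml T V → Prop
  | _, v, eq t s => t = Sum.inl v ∨ s = Sum.inl v
  | _, v, rel _ t => ∃ i, t i = Sum.inl v
  | _, v, neg φ => φ.OccursFree v
  | _, v, conj φ => ∃ i, (φ i).OccursFree v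
  | _, v, disj φ => ∃ i, (φ i).OccursFree v
  | _, v, all _ φ => φ.OccursFree (Sum.inl v)
  | _, v, ex _ φ => φ.OccursFree (Sum.inl v)

/-- `φ¬`: moving a negation inside. -/
def moveNeg : {V : Type u} → Fml T V → Fml T V
  | _, eq t s => neg (eq t s)
  | _, rel R t => neg (rel R t)
  | _, neg φ => φ
  | _, conj φ => disj (fun i => neg (φ i))
  | _, disj φ => conj (fun i => neg (φ i))
  | _, all W φ => ex W (neg φ)
  | _, ex W φ => all W (neg φ)

/-- A sentence seen as a formula whose free variables are (vacuously) among `X`. -/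
def ofSentence {X : Type u} (φ : Sentence T) : Fml T X := φ.subst PEmpty.elim

end Fml

/-- The sentence `c = d` for constants `c`, `d`. -/
def eqC {T : Signature.{u}} (c d : T.Const) : Sentence T := Fml.eq (Sum.inr c) (Sum.inr d)

/-- The sentence `R(c₁, …, cₙ)` for constants `cᵢ`. -/
def relC {T : Signature.{u}} {n : ℕ} (R : T.Rel n) (c : Fin n → T.Const) : Sentence T :=
  Fml.rel R (fun i => Sum.inr (c i))

/-! ## The sequent calculus -/

/-- Derivable sequents of the infinitary sequent calculus, with variables from `X`. The rules are
those for `¬`, `⋀` and `∀`; the last four axioms say that `⋁` and `∃` abbreviate `¬⋀¬` and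
`¬∀¬`. -/
inductive Derivable {T : Signature.{u}} {X : Type u} : Set (Fml T X) → Set (Fml T X) → Prop
  | ax (Γ Δ : Set (Fml T X)) (φ : Fml T X) : Derivable (insert φ Γ) (insert φ Δ)
  | cut {Γ Γ' Δ Δ' : Set (Fml T X)} {φ : Fml T X} :
      Derivable (insert φ Γ) Δ → Derivable Γ' (insert φ Δ') → Derivable (Γ ∪ Γ') (Δ ∪ Δ')
  | subst {Γ Δ : Set (Fml T X)} (σ : X → X) : Derivable Γ Δ →
      Derivable ((fun φ : Fml T X => φ.subst (fun x => Sum.inl (σ x))) '' Γ)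
        ((fun φ : Fml T X => φ.subst (fun x => Sum.inl (σ x))) '' Δ)
  | weak {Γ Δ : Set (Fml T X)} (Γ' Δ' : Set (Fml T X)) : Derivable Γ Δ →
      Derivable (Γ ∪ Γ') (Δ ∪ Δ')
  | negL {Γ Δ : Set (Fml T X)} {φ : Fml T X} : Derivable Γ (insert φ Δ) →
      Derivable (insert (Fml.neg φ) Γ) Δ
  | negR {Γ Δ : Set (Fml T X)} {φ : Fml T X} : Derivable (insert φ Γ) Δ →
      Derivable Γ (insert (Fml.neg φ) Δ)
  | conjL {Γ Δ : Set (Fml T X)} {ι : Type u} (φ : ι → Fml T X) : Derivable (Γ ∪ Set.range φ) Δ →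
      Derivable (insert (Fml.conj φ) Γ) Δ
  | conjR {Γ Δ : Set (Fml T X)} {ι : Type u} (φ : ι → Fml T X) :
      (∀ i, Derivable Γ (insert (φ i) Δ)) → Derivable Γ (insert (Fml.conj φ) Δ)
  | allL {Γ Δ : Set (Fml T X)} {W : Type u} (φ : Fml T (X ⊕ W)) (t : W → T.Term X) :
      Derivable (insert (φ.inst t) Γ) Δ → Derivable (insert (Fml.all W φ) Γ) Δ
  | allR {Γ Δ : Set (Fml T X)} {W : Type u} (φ : Fml T (X ⊕ W)) (x : W → X)
      (hinj : Function.Injective x)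
      (hΓ : ∀ ψ ∈ Γ, ∀ i, ¬ ψ.OccursFree (x i)) (hΔ : ∀ ψ ∈ Δ, ∀ i, ¬ ψ.OccursFree (x i))
      (hφ : ∀ i, ¬ φ.OccursFree (Sum.inl (x i))) :
      Derivable Γ (insert (φ.inst (fun i => Sum.inl (x i))) Δ) →
      Derivable Γ (insert (Fml.all W φ) Δ)
  | eqSymm (x y : X) :
      Derivable {Fml.eq (Sum.inl x) (Sum.inl y)} {Fml.eq (Sum.inl y) (Sum.inl x)}
  | eqSubst {W : Type u} (φ : Fml T (X ⊕ W)) (s t : W → T.Term X) :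
      Derivable (insert (φ.inst t) (Set.range (fun i => Fml.eq (s i) (t i)))) {φ.inst s}
  | disjL {ι : Type u} (φ : ι → Fml T X) :
      Derivable {Fml.disj φ} {Fml.neg (Fml.conj (fun i => Fml.neg (φ i)))}
  | disjR {ι : Type u} (φ : ι → Fml T X) :
      Derivable {Fml.neg (Fml.conj (fun i => Fml.neg (φ i)))} {Fml.disj φ}
  | exL {W : Type u} (φ : Fml T (X ⊕ W)) :
      Derivable {Fml.ex W φ} {Fml.neg (Fml.all W (Fml.neg φ))}
  | exR {W : Type u} (φ : Fml T (X ⊕ W)) :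
      Derivable {Fml.neg (Fml.all W (Fml.neg φ))} {Fml.ex W φ}

/-- `Γ ⊢ Δ` for sets of sentences: there is a derivation using some set `X` of variables. -/
def Proves {T : Signature.{u}} (Γ Δ : Set (Sentence T)) : Prop :=
  ∃ X : Type u, Derivable (X := X) (Fml.ofSentence '' Γ) (Fml.ofSentence '' Δ)

/-! ## Consistency properties -/

/-- Consistency properties for `L(C)_{∞∞}`. Being small in the universe of `L` and `C` means being
a set, as opposed to a proper class. -/
structure ConsistencyProperty (L : Signature.{u}) (C : Type u) where
  sets : Set (Set (Sentence (L.adjoin C)))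
  small_sets : Small.{u} sets
  small_mem : ∀ s ∈ sets, Small.{u} s
  con : ∀ s ∈ sets, ∀ φ : Sentence (L.adjoin C), φ ∉ s ∨ Fml.neg φ ∉ s
  ind1 : ∀ s ∈ sets, ∀ φ : Sentence (L.adjoin C), Fml.neg φ ∈ s → insert φ.moveNeg s ∈ sets
  ind2 : ∀ s ∈ sets, ∀ (ι : Type u) (φ : ι → Sentence (L.adjoin C)),
    Fml.conj φ ∈ s → ∀ i, insert (φ i) s ∈ sets
  ind3 : ∀ s ∈ sets, ∀ (W : Type u) (φ : Fml (L.adjoin C) (PEmpty ⊕ W)),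
    Fml.all W φ ∈ s → ∀ c : W → (L.adjoin C).Const, insert (φ.instConst c) s ∈ sets
  ind4 : ∀ s ∈ sets, ∀ (ι : Type u) (φ : ι → Sentence (L.adjoin C)),
    Fml.disj φ ∈ s → ∃ i, insert (φ i) s ∈ sets
  ind5 : ∀ s ∈ sets, ∀ (W : Type u) (φ : Fml (L.adjoin C) (PEmpty ⊕ W)),
    Fml.ex W φ ∈ s → ∃ c : W → C, insert (φ.instConst (fun i => Sum.inr (c i))) s ∈ sets
  str1 : ∀ s ∈ sets, ∀ c d : (L.adjoin C).Const, eqC c d ∈ s → insert (eqC d c) s ∈ sets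
  str2 : ∀ s ∈ sets, ∀ (c d : (L.adjoin C).Const) (φ : Fml (L.adjoin C) (PEmpty ⊕ PUnit.{u + 1})),
    eqC c d ∈ s → φ.instConst (fun _ => d) ∈ s → insert (φ.instConst (fun _ => c)) s ∈ sets
  str3 : ∀ s ∈ sets, ∀ d : (L.adjoin C).Const,
    ∃ c : C, insert (eqC (T := L.adjoin C) (Sum.inr c) d) s ∈ sets

/-! ## Forcing: Boolean valued sets over the regular open algebra of a partial order -/

/-- `RO(P)`: the regular open subsets of `P`, the open sets being the downward closed ones. -/
abbrev RO (P : Type w) [PartialOrder P] : Type w := Heyting.Regular (LowerSet P)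

instance (P : Type w) [PartialOrder P] : CompleteBooleanAlgebra (RO P) :=
  { (inferInstance : BooleanAlgebra (Heyting.Regular (LowerSet P))),
    (Heyting.Regular.gi (α := LowerSet P)).liftCompleteLattice with }

/-- The image of `p` in `RO(P)`: the regularization of `{q | q ≤ p}`. -/
def RO.of {P : Type w} [PartialOrder P] (p : P) : RO P :=
  Heyting.Regular.toRegular (LowerSet.Iic p)

/-- The Boolean valued universe `V^B`: a `B`-name is a set-indexed family of `B`-names, each with a
Boolean value in `B`. -/
inductive BName (B : Type w) : Type (max (u + 1) w)
  | mk (ι : Type u) (elt : ι → BName B) (val : ι → B) : BName B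

namespace BName

variable {B : Type w} [CompleteBooleanAlgebra B]

/-- The Boolean value of `x = y` in `V^B`. -/
def beq : BName.{u} B → BName.{u} B → B
  | mk _ x a, mk _ y b =>
    (⨅ i, a i ⇨ ⨆ j, b j ⊓ beq (x i) (y j)) ⊓ (⨅ j, b j ⇨ ⨆ i, a i ⊓ beq (x i) (y j))

/-- The Boolean value of `x ∈ y` in `V^B`. -/
def bmem (x : BName.{u} B) : BName.{u} B → B
  | mk _ y b => ⨆ j, b j ⊓ beq x (y j)

/-- The canonical name of a set of the ground universe. -/
def check : PSet.{u} → BName.{u} B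
  | PSet.mk ι x => mk ι (fun i => check (x i)) (fun _ => ⊤)

end BName

/-- A set (in bijection with a type in `Type u`) is identified with a set of ordinals of the
cumulative hierarchy, along some well-order. -/
def code {α : Type w} [Small.{u} α] (a : α) : PSet.{u} :=
  (Ordinal.typein (WellOrderingRel (α := Shrink.{u} α)) (equivShrink α a)).toPSet

/-- A structure for the signature `T` in `V^B`: a name for its domain, the Boolean values of
its relations, and names for its constants. -/
structure BStructure (B : Type w) (T : Signature.{u}) where
  dom : BName.{u} B
  rel : {n : ℕ} → T.Rel n → (Fin n → BName.{u} B) → B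
  const : T.Const → BName.{u} B

namespace BStructure

variable {B : Type w} [CompleteBooleanAlgebra B] {T : Signature.{u}}

/-- The value of a term under an assignment of names to its variables. -/
def term (A : BStructure B T) {V : Type u} (σ : V → BName.{u} B) : T.Term V → BName.{u} B :=
  Sum.elim σ A.const

/-- The Boolean value, in `V^B`, of the Tarski satisfaction `A ⊨ φ[σ]`; quantifiers range over the
strings of names for elements of the domain of `A`. -/
def sat (A : BStructure B T) : {V : Type u} → Fml T V → (V → BName.{u} B) → B
  | _, Fml.eq t s, σ => (A.term σ t).beq (A.term σ s)
  | _, Fml.rel R t, σ => A.rel R (fun i => A.term σ (t i))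
  | _, Fml.neg φ, σ => (A.sat φ σ)ᶜ
  | _, Fml.conj φ, σ => ⨅ i, A.sat (φ i) σ
  | _, Fml.disj φ, σ => ⨆ i, A.sat (φ i) σ
  | _, Fml.all W φ, σ =>
    ⨅ τ : W → BName.{u} B, (⨅ i, (τ i).bmem A.dom) ⇨ A.sat φ (Sum.elim σ τ)
  | _, Fml.ex W φ, σ =>
    ⨆ τ : W → BName.{u} B, (⨅ i, (τ i).bmem A.dom) ⊓ A.sat φ (Sum.elim σ τ)

/-- The Boolean value of `A ⊨ ψ` for a sentence `ψ`. -/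
def satS (A : BStructure B T) (ψ : Sentence T) : B := A.sat ψ PEmpty.elim

end BStructure

/-! ## The forcing notion of a consistency property and its term model -/

namespace ConsistencyProperty

variable {L : Signature.{u}} {C : Type u} (S : ConsistencyProperty L C)

/-- `S` consists of sets of `L(C)_{∞ω}`-sentences. -/
def IsFinitary : Prop := ∀ s ∈ S.sets, ∀ φ ∈ s, φ.IsFinitary

/-- The forcing notion `P_S`: subsets of elements of `S`, ordered by reverse inclusion. -/
def Cond : Type (u + 1) := {p : Set (Sentence (L.adjoin C)) // ∃ s ∈ S.sets, p ⊆ s}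

instance : PartialOrder S.Cond where
  le p q := q.1 ⊆ p.1
  le_refl p := subset_rfl
  le_trans _ _ _ h h' := h'.trans h
  le_antisymm _ _ h h' := Subtype.ext (h'.antisymm h)

instance : Small.{u} S.Cond := by
  have h1 : Small.{u} S.sets := S.small_sets
  have h2 : ∀ s : S.sets, Small.{u} s.1 := fun s => S.small_mem s.1 s.2
  refine small_of_surjective (α := Σ s : S.sets, Set s.1)
    (f := fun x => ⟨Subtype.val '' x.2, x.1.1, x.1.2, by rintro _ ⟨y, _, rfl⟩; exact y.2⟩) ?_
  rintro ⟨p, s, hs, hp⟩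
  exact ⟨⟨⟨s, hs⟩, Subtype.val ⁻¹' p⟩, Subtype.ext (by simpa using hp)⟩

/-- The canonical name of a condition of `P_S`. -/
def condName (p : S.Cond) : BName.{u} (RO S.Cond) := BName.check (code p)

/-- The canonical name for the `V`-generic filter `F` on `P_S`: a condition `p` belongs to it with
Boolean value the image of `p` in `RO(P_S)`. -/
def genericName : BName.{u} (RO S.Cond) :=
  BName.mk (Shrink.{u} S.Cond) (fun p => S.condName ((equivShrink S.Cond).symm p))
    (fun p => RO.of ((equivShrink S.Cond).symm p))

/-- The Boolean value of `ψ ∈ Σ_F`, where `Σ_F = ⋃ F`: some `p ∈ F` has `ψ` as an element. -/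
def memSigma (ψ : Sentence (L.adjoin C)) : RO S.Cond :=
  ⨆ p : {p : S.Cond // ψ ∈ p.1}, (S.condName p.1).bmem S.genericName

/-- The name for the class `[c]_F = {d | (c = d) ∈ Σ_F}` of a constant `c`. -/
def className (c : (L.adjoin C).Const) : BName.{u} (RO S.Cond) :=
  BName.mk (L.adjoin C).Const (fun d => BName.check (code d)) (fun d => S.memSigma (eqC c d))

/-- The term model `A_F`, as an object of the extension: its domain is the set of all classes
`[c]_F`, a constant `c` is interpreted by `[c]_F`, and a relation `R` holds of `x₁, …, xₙ` iff there
are constants with `xᵢ = [cᵢ]_F` and `R(c₁, …, cₙ) ∈ Σ_F`. -/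
def termModel : BStructure (RO S.Cond) (L.adjoin C) where
  dom := BName.mk (L.adjoin C).Const S.className (fun _ => ⊤)
  rel {n} R x := ⨆ c : Fin n → (L.adjoin C).Const,
    (⨅ i, (x i).beq (S.className (c i))) ⊓ S.memSigma (relC R c)
  const := S.className

/-- The name for the set `{[c]_F | c ∈ C}` of the classes of the new constants. -/
def newClasses : BName.{u} (RO S.Cond) :=
  BName.mk C (fun c => S.className (Sum.inr c)) (fun _ => ⊤)

end ConsistencyProperty

end InfLogic

end

noncomputable section

namespace InfLogic

/-! ## Complete Boolean algebras -/

/-! Everything is computed with Boolean values in `RO S.Cond`; no generic filter is ever chosen. If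
a condition `p` forces `ψ ∈ Σ_F`, then some `s ∈ S.sets` contains both `p` and `ψ`
(`exists_of_le_memSigma`). Each clause of a consistency property then says that a certain set of
conditions is dense, and turns into an inequality between values `S.memSigma _`.

The (Str) clauses make equality in Σ_F an equivalence relation compatible with the relation symbols,
so that equality of the names `S.className c` has the expected value (`className_beq_eq`,
`termModel_rel_className`), and every class contains a new constant.

Truth (`memSigma_subst_le_sat`) goes by induction on formulae, for `φ` and `¬φ` together: (Ind.1)
replaces `¬φ` by `φ¬`, whose immediate constituents are negations of those of `φ`. At a quantifier,
names for elements of the domain must be traded for constants of the ground model. For a finite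
string this is finite distributivity; an infinite string of classes in the extension need not come
from a string of constants in the ground model, whence the restriction to finite strings.

For the corollary, the calculus is sound in Boolean valued structures (`valid_of_derivable`). The
condition `s` forces all its own sentences, so a derivation of `s ⊢ ∅` would give it the value `⊥`,
whereas no condition has image `⊥`. -/

theorem iInf_iSup_le_iSup_iInf_of_finite {B : Type*} [Order.Frame B] {W D : Type*} [Finite W]
    [Nonempty D] (f : W → D → B) : ⨅ i, ⨆ d, f i d ≤ ⨆ g : W → D, ⨅ i, f i (g i) := by
  classical
  have key : ∀ s : Finset W, ⨅ i ∈ s, ⨆ d, f i d ≤ ⨆ g : W → D, ⨅ i ∈ s, f i (g i) := by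
    intro s
    induction s using Finset.induction_on with
    | empty =>
      exact le_iSup_of_le (fun _ => Classical.arbitrary D) (by simp)
    | insert i s hi ih =>
      rw [Finset.iInf_insert]
      refine (inf_le_inf_left _ ih).trans ?_
      rw [iSup_inf_iSup]
      -- Since `i ∉ s`, changing `g` at `i` does not disturb the choices already made on `s`.
      refine iSup_le fun ⟨d, g⟩ => le_iSup_of_le (Function.update g i d) ?_
      rw [Finset.iInf_insert]
      refine inf_le_inf (by simp) (le_iInf₂ fun j hj => (iInf₂_le j hj).trans ?_)
      rw [Function.update_of_ne (by rintro rfl; exact hi hj)]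
  have : Fintype W := Fintype.ofFinite W
  simpa using key Finset.univ

/-! ## The regular open algebra -/

-- These fix the path through the complete Boolean algebra structure, which is not reducibly
-- equal to Mathlib's operations on `Heyting.Regular`.
local instance RO.instMin {P : Type w} [PartialOrder P] : Min (RO P) := SemilatticeInf.toMin

local instance RO.instCompl {P : Type w} [PartialOrder P] : Compl (RO P) := HeytingAlgebra.toCompl

local instance RO.instTop {P : Type w} [PartialOrder P] : Top (RO P) := OrderTop.toTop

local instance RO.instBot {P : Type w} [PartialOrder P] : Bot (RO P) := OrderBot.toBot

namespace RO

variable {P : Type w} [PartialOrder P]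

theorem le_of {p q : P} (h : p ≤ q) : RO.of p ≤ RO.of q :=
  Heyting.Regular.toRegular.monotone (LowerSet.Iic_le.2 h)

theorem of_le_iff {p : P} {b : RO P} : RO.of p ≤ b ↔ p ∈ (b : LowerSet P) :=
  (Heyting.Regular.gi.gc _ _).trans LowerSet.Iic_le

theorem of_ne_bot (p : P) : RO.of p ≠ ⊥ := by
  intro h
  have : p ∈ ((⊥ : RO P) : LowerSet P) := of_le_iff.1 h.le
  exact this

theorem exists_of_le {b : RO P} (hb : b ≠ ⊥) : ∃ p, RO.of p ≤ b := by
  by_contra! h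
  refine hb (Heyting.Regular.coe_injective (LowerSet.ext ?_))
  ext p
  exact ⟨fun hp => (h p (of_le_iff.2 hp)).elim, fun hp => False.elim hp⟩

theorem of_inf_of (p q : P) :
    RO.of p ⊓ RO.of q = Heyting.Regular.toRegular (LowerSet.Iic p ⊓ LowerSet.Iic q) := by
  refine Heyting.Regular.coe_injective ((Heyting.Regular.coe_inf _ _).trans ?_)
  simp [RO.of, compl_compl_inf_distrib]

/-- Regularization commutes with finite meets, so incompatible conditions have disjoint images. -/
theorem exists_le_of_inf_ne_bot {p q : P} (h : RO.of p ⊓ RO.of q ≠ ⊥) : ∃ r, r ≤ p ∧ r ≤ q := by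
  by_contra! h'
  refine h ?_
  rw [of_inf_of, show LowerSet.Iic p ⊓ LowerSet.Iic q = ⊥ from ?_]
  · apply Heyting.Regular.coe_injective
    simp
  · ext r
    simpa using h' r

/-- The density principle behind every forcing argument below: a condition under `a ⊓ bᶜ` would have
an extension under both `b` and `bᶜ`. -/
theorem le_of_forall_exists {a b : RO P}
    (h : ∀ p, RO.of p ≤ a → ∃ r ≤ p, RO.of r ≤ b) : a ≤ b := by
  by_contra hab
  obtain ⟨p, hp⟩ := exists_of_le (b := a ⊓ bᶜ)
    (fun h => hab (disjoint_compl_right_iff.1 (disjoint_iff.2 h)))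
  obtain ⟨r, hrp, hr⟩ := h p (hp.trans inf_le_left)
  refine of_ne_bot r (le_bot_iff.1 ?_)
  calc RO.of r ≤ b ⊓ bᶜ := le_inf hr ((le_of hrp).trans (hp.trans inf_le_right))
    _ = ⊥ := inf_compl_self b

/-- A condition forcing a disjunction has an extension that decides which disjunct holds. -/
theorem exists_of_le_iSup {ι : Sort*} {f : ι → RO P} {p : P} (h : RO.of p ≤ ⨆ i, f i) :
    ∃ r ≤ p, ∃ i, RO.of r ≤ f i := by
  by_contra! h'
  refine of_ne_bot p (le_bot_iff.1 ?_)
  have hp : ∀ i, RO.of p ⊓ f i = ⊥ := by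
    intro i
    by_contra hi
    obtain ⟨q, hq⟩ := exists_of_le hi
    have hpq : RO.of p ⊓ RO.of q = RO.of q := inf_eq_right.2 (hq.trans inf_le_left)
    obtain ⟨r, hrp, hrq⟩ := exists_le_of_inf_ne_bot fun h => of_ne_bot q (hpq.symm.trans h)
    exact h' r hrp i ((le_of hrq).trans (hq.trans inf_le_right))
  calc RO.of p ≤ RO.of p ⊓ ⨆ i, f i := le_inf le_rfl h
    _ = ⨆ i, RO.of p ⊓ f i := inf_iSup_eq _ _
    _ ≤ ⊥ := by simp [hp]

end RO

/-! ## Equality of names -/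

namespace BName

variable {B : Type w} [CompleteBooleanAlgebra B]

theorem le_beq_mk_iff {b : B} {ι κ : Type u} {x : ι → BName.{u} B} {a : ι → B}
    {y : κ → BName.{u} B} {c : κ → B} :
    b ≤ (mk ι x a).beq (mk κ y c) ↔
      (∀ i, b ⊓ a i ≤ ⨆ j, c j ⊓ (x i).beq (y j)) ∧
      (∀ j, b ⊓ c j ≤ ⨆ i, a i ⊓ (x i).beq (y j)) := by
  simp [beq, le_inf_iff, le_iInf_iff, le_himp_iff]

theorem beq_refl (x : BName.{u} B) : x.beq x = ⊤ := by
  induction x with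
  | mk ι x a ih =>
    refine top_le_iff.1 (le_beq_mk_iff.2 ⟨fun i => ?_, fun i => ?_⟩) <;>
      exact le_iSup_of_le i (by simp [ih])

theorem beq_comm (x y : BName.{u} B) : x.beq y = y.beq x := by
  induction x generalizing y with
  | mk ι x a ih =>
    cases y with
    | mk κ y c =>
      simp only [beq]
      rw [inf_comm]
      simp only [ih]

/-- An element of `x` is matched with one of `y` and then with one of `z`; the induction hypothesis
composes the two matches. The second half runs the same chase from `z` back to `x`. -/
theorem beq_trans (x y z : BName.{u} B) : x.beq y ⊓ y.beq z ≤ x.beq z := by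
  induction x generalizing y z with
  | mk ι x a ih =>
    cases y with
    | mk κ y b =>
      cases z with
      | mk μ z c =>
        have h1 := (le_beq_mk_iff (x := x) (a := a) (y := y) (c := b)).1 le_rfl
        have h2 := (le_beq_mk_iff (x := y) (a := b) (y := z) (c := c)).1 le_rfl
        set p := (mk ι x a).beq (mk κ y b)
        set q := (mk κ y b).beq (mk μ z c)
        refine le_beq_mk_iff.2 ⟨fun i => ?_, fun k => ?_⟩
        · calc p ⊓ q ⊓ a i = q ⊓ (p ⊓ a i) := by ac_rfl
            _ ≤ q ⊓ ⨆ j, b j ⊓ (x i).beq (y j) := inf_le_inf_left _ (h1.1 i)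
            _ = ⨆ j, (q ⊓ b j) ⊓ (x i).beq (y j) := by simp only [inf_iSup_eq, inf_assoc]
            _ ≤ ⨆ j, (⨆ k, c k ⊓ (y j).beq (z k)) ⊓ (x i).beq (y j) :=
              iSup_mono fun j => inf_le_inf_right _ (h2.1 j)
            _ ≤ _ := by
              refine iSup_le fun j => ?_
              rw [iSup_inf_eq]
              refine iSup_mono fun k => ?_
              rw [inf_assoc, inf_comm ((y j).beq _)]
              exact inf_le_inf_left _ (ih i _ _)
        · calc p ⊓ q ⊓ c k = p ⊓ (q ⊓ c k) := by ac_rfl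
            _ ≤ p ⊓ ⨆ j, b j ⊓ (y j).beq (z k) := inf_le_inf_left _ (h2.2 k)
            _ = ⨆ j, (p ⊓ b j) ⊓ (y j).beq (z k) := by simp only [inf_iSup_eq, inf_assoc]
            _ ≤ ⨆ j, (⨆ i, a i ⊓ (x i).beq (y j)) ⊓ (y j).beq (z k) :=
              iSup_mono fun j => inf_le_inf_right _ (h1.2 j)
            _ ≤ _ := by
              refine iSup_le fun j => ?_
              rw [iSup_inf_eq]
              refine iSup_mono fun i => ?_
              rw [inf_assoc]
              exact inf_le_inf_left _ (ih i _ _)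

theorem beq_check_of_equiv {x y : PSet.{u}} (h : x.Equiv y) :
    (check x : BName.{u} B).beq (check y) = ⊤ := by
  induction x generalizing y with
  | mk ι x ih =>
    cases y with
    | mk κ y =>
      obtain ⟨h1, h2⟩ := h
      refine top_le_iff.1 (le_beq_mk_iff.2 ⟨fun i => ?_, fun j => ?_⟩)
      · obtain ⟨j, hj⟩ := h1 i
        exact le_iSup_of_le j (by simp [ih i hj])
      · obtain ⟨i, hi⟩ := h2 j
        exact le_iSup_of_le i (by simp [ih i hi])

theorem beq_check_of_not_equiv {x y : PSet.{u}} (h : ¬ x.Equiv y) :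
    (check x : BName.{u} B).beq (check y) = ⊥ := by
  induction x generalizing y with
  | mk ι x ih =>
    cases y with
    | mk κ y =>
      have hl := (le_beq_mk_iff (B := B) (x := fun i => check (x i)) (a := fun _ => ⊤)
        (y := fun i => check (y i)) (c := fun _ => ⊤)).1 le_rfl
      by_cases h1 : ∀ i, ∃ j, (x i).Equiv (y j)
      · have h2 : ¬ ∀ j, ∃ i, (x i).Equiv (y j) := fun h2 => h ⟨h1, h2⟩
        push Not at h2
        obtain ⟨j, hj⟩ := h2
        have := hl.2 j
        simp only [fun i => ih i (hj i), inf_top_eq, inf_bot_eq, iSup_bot] at this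
        exact le_bot_iff.1 this
      · push Not at h1
        obtain ⟨i, hi⟩ := h1
        have := hl.1 i
        simp only [fun j => ih i (hi j), inf_top_eq, inf_bot_eq, iSup_bot] at this
        exact le_bot_iff.1 this

end BName

/-- The rank of a von Neumann ordinal is the ordinal itself, and distinct elements have distinct
positions in the well-order. -/
theorem code_equiv_iff {α : Type w} [Small.{u} α] {a b : α} :
    (code.{u} a).Equiv (code.{u} b) ↔ a = b := by
  refine ⟨fun h => ?_, fun h => h ▸ PSet.Equiv.refl _⟩
  have h' := PSet.rank_congr h
  simp only [code, Ordinal.rank_toPSet] at h'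
  exact (equivShrink α).injective (Ordinal.typein_injective _ h')

theorem beq_check_code {B : Type w} [CompleteBooleanAlgebra B] {α : Type*} [Small.{u} α]
    [DecidableEq α] (a b : α) :
    (BName.check (code.{u} a) : BName.{u} B).beq (BName.check (code b)) =
      if a = b then ⊤ else ⊥ := by
  split_ifs with h
  · exact BName.beq_check_of_equiv (code_equiv_iff.2 h)
  · exact BName.beq_check_of_not_equiv (fun h' => h (code_equiv_iff.1 h'))

/-- Equality of check names acts as a Kronecker delta, so the membership value of a coded element is
its own weight. This evaluates both the generic name and the class names. -/
theorem iSup_inf_beq_check_code {B : Type w} [CompleteBooleanAlgebra B] {α : Type*} [Small.{u} α]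
    {ι : Type*} (e : ι ≃ α) (f : ι → B) (a : α) :
    ⨆ i, f i ⊓ (BName.check (code.{u} a) : BName.{u} B).beq (BName.check (code (e i))) =
      f (e.symm a) := by
  classical
  refine le_antisymm (iSup_le fun i => ?_) (le_iSup_of_le (e.symm a) ?_)
  · rw [beq_check_code]
    split_ifs with h
    · simp [h]
    · simp
  · simp [beq_check_code]

/-! ## Substitution -/

namespace Fml

variable {T : Signature.{u}}

theorem subst_congr {V V' : Type u} (φ : Fml T V) {σ τ : V → T.Term V'} (h : ∀ v, σ v = τ v) :
    φ.subst σ = φ.subst τ := by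
  rw [funext h]

theorem subst_inl {V : Type u} (φ : Fml T V) : φ.subst Sum.inl = φ := by
  have ht : ∀ {V : Type u} (t : T.Term V), substTerm Sum.inl t = t := by
    rintro V (v | c) <;> rfl
  have hl : ∀ V W : Type u,
      liftSubst W (Sum.inl : V → T.Term V) = (Sum.inl : V ⊕ W → T.Term (V ⊕ W)) := by
    intro V W
    funext v
    cases v <;> rfl
  induction φ with
  | eq t s => simp [subst, ht]
  | rel R t => simp [subst, ht]
  | neg φ ih => simp [subst, ih]
  | conj φ ih => simp [subst, ih]
  | disj φ ih => simp [subst, ih]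
  | all W φ ih => simp [subst, hl, ih]
  | ex W φ ih => simp [subst, hl, ih]

theorem subst_subst {V V' V'' : Type u} (φ : Fml T V) (σ : V → T.Term V') (τ : V' → T.Term V'') :
    (φ.subst σ).subst τ = φ.subst (fun v => substTerm τ (σ v)) := by
  have ht : ∀ {V V' V'' : Type u} (σ : V → T.Term V') (τ : V' → T.Term V'') (t : T.Term V),
      substTerm τ (substTerm σ t) = substTerm (fun v => substTerm τ (σ v)) t := by
    rintro V V' V'' σ τ (v | c) <;> rfl
  have hl : ∀ {V V' V'' : Type u} (W : Type u) (σ : V → T.Term V') (τ : V' → T.Term V''),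
      (fun v => substTerm (liftSubst W τ) (liftSubst W σ v)) =
        liftSubst W (fun v => substTerm τ (σ v)) := by
    intro V V' V'' W σ τ
    funext v
    rcases v with v | x
    · simp only [liftSubst, Sum.elim_inl]
      cases σ v <;> rfl
    · rfl
  induction φ generalizing V' V'' with
  | eq t s => simp [subst, ht]
  | rel R t => simp [subst, ht]
  | neg φ ih => simp [subst, ih]
  | conj φ ih => simp [subst, ih]
  | disj φ ih => simp [subst, ih]
  | all W φ ih => simp [subst, hl, ih]
  | ex W φ ih => simp [subst, hl, ih]

/-- Brings an instance of a quantified formula into the form to which the induction hypothesis of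
the truth lemma applies. -/
theorem instConst_subst_liftSubst {V V' W : Type u} (φ : Fml T (V ⊕ W)) (c : V → T.Const)
    (d : W → T.Const) :
    (φ.subst (liftSubst (V' := V') W (fun v => Sum.inr (c v)))).instConst d =
      φ.subst (fun v => Sum.inr (Sum.elim c d v)) := by
  rw [instConst, inst, subst_subst]
  refine subst_congr _ ?_
  rintro (v | x) <;> rfl

end Fml

/-! ## Boolean valued satisfaction -/

namespace BStructure

theorem term_substTerm {B : Type w} {T : Signature.{u}} (A : BStructure B T) {V V' : Type u} (ρ : V → T.Term V') (σ : V' → BName.{u} B)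
    (t : T.Term V) : A.term σ (Fml.substTerm ρ t) = A.term (fun v => A.term σ (ρ v)) t := by
  cases t <;> rfl

variable {B : Type w} [CompleteBooleanAlgebra B] {T : Signature.{u}} (A : BStructure B T)

theorem sat_subst {V V' : Type u} (φ : Fml T V) (ρ : V → T.Term V') (σ : V' → BName.{u} B) :
    A.sat (φ.subst ρ) σ = A.sat φ (fun v => A.term σ (ρ v)) := by
  have hl : ∀ {V V' : Type u} (W : Type u) (ρ : V → T.Term V') (σ : V' → BName.{u} B)
      (τ : W → BName.{u} B), (fun v => A.term (Sum.elim σ τ) (Fml.liftSubst W ρ v)) =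
        Sum.elim (fun v => A.term σ (ρ v)) τ := by
    intro V V' W ρ σ τ
    funext v
    rcases v with v | x
    · simp only [Fml.liftSubst, Sum.elim_inl]
      cases ρ v <;> rfl
    · rfl
  induction φ generalizing V' with
  | eq t s => simp [Fml.subst, sat, term_substTerm]
  | rel R t => simp [Fml.subst, sat, term_substTerm]
  | neg φ ih => simp [Fml.subst, sat, ih]
  | conj φ ih => simp [Fml.subst, sat, ih]
  | disj φ ih => simp [Fml.subst, sat, ih]
  | all W φ ih => simp [Fml.subst, sat, ih, hl]
  | ex W φ ih => simp [Fml.subst, sat, ih, hl]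

theorem sat_inst {V W : Type u} (φ : Fml T (V ⊕ W)) (t : W → T.Term V) (σ : V → BName.{u} B) :
    A.sat (φ.inst t) σ = A.sat φ (Sum.elim σ (fun i => A.term σ (t i))) := by
  rw [Fml.inst, sat_subst]
  congr 1
  funext v
  cases v <;> rfl

theorem sat_congr_of_occursFree {V : Type u} (φ : Fml T V) {σ τ : V → BName.{u} B}
    (h : ∀ v, φ.OccursFree v → σ v = τ v) : A.sat φ σ = A.sat φ τ := by
  have ht : ∀ {V : Type u} {σ τ : V → BName.{u} B} (t : T.Term V),
      (∀ v, t = Sum.inl v → σ v = τ v) → A.term σ t = A.term τ t := by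
    rintro V σ τ (v | c) h
    · exact h v rfl
    · rfl
  induction φ with
  | eq t s =>
    simp only [sat]
    rw [ht t fun v hv => h v (Or.inl hv), ht s fun v hv => h v (Or.inr hv)]
  | rel R t =>
    simp only [sat]
    congr 1
    funext i
    exact ht (t i) fun v hv => h v ⟨i, hv⟩
  | neg φ ih => simp only [sat]; rw [ih h]
  | conj φ ih => simp only [sat]; exact iInf_congr fun i => ih i fun v hv => h v ⟨i, hv⟩
  | disj φ ih => simp only [sat]; exact iSup_congr fun i => ih i fun v hv => h v ⟨i, hv⟩
  | all W φ ih =>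
    simp only [sat]
    refine iInf_congr fun ρ => ?_
    rw [ih]
    rintro (v | x) hv
    · exact h v hv
    · rfl
  | ex W φ ih =>
    simp only [sat]
    refine iSup_congr fun ρ => ?_
    rw [ih]
    rintro (v | x) hv
    · exact h v hv
    · rfl

/-- The relations of the structure respect equality. -/
def RelCongr : Prop :=
  ∀ (n : ℕ) (R : T.Rel n) (x y : Fin n → BName.{u} B),
    (⨅ i, (x i).beq (y i)) ⊓ A.rel R x ≤ A.rel R y

variable {A}

/-- Leibniz's law. Negation reverses the inequality, so its case uses the induction hypothesis with
`σ` and `τ` exchanged, equality being symmetric. -/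
theorem inf_sat_le_sat (hA : A.RelCongr) {V : Type u} (φ : Fml T V) (σ τ : V → BName.{u} B) :
    (⨅ v, (σ v).beq (τ v)) ⊓ A.sat φ σ ≤ A.sat φ τ := by
  have ht : ∀ {V : Type u} (σ τ : V → BName.{u} B) (t : T.Term V),
      ⨅ v, (σ v).beq (τ v) ≤ (A.term σ t).beq (A.term τ t) := by
    rintro V σ τ (v | c)
    · exact iInf_le _ v
    · exact le_top.trans (BName.beq_refl _).ge
  have he : ∀ {V : Type u} (W : Type u) (σ τ : V → BName.{u} B) (ρ : W → BName.{u} B),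
      ⨅ v, (σ v).beq (τ v) ≤ ⨅ v, (Sum.elim σ ρ v).beq (Sum.elim τ ρ v) := by
    intro V W σ τ ρ
    rw [iInf_sum]
    simp [BName.beq_refl]
  induction φ with
  | eq t s =>
    simp only [sat]
    calc _ ≤ (A.term τ t).beq (A.term σ t) ⊓ ((A.term σ t).beq (A.term σ s) ⊓
          (A.term σ s).beq (A.term τ s)) := by
          refine le_inf (inf_le_left.trans ((ht σ τ t).trans (BName.beq_comm _ _).le)) ?_
          exact le_inf inf_le_right (inf_le_left.trans (ht σ τ s))
      _ ≤ _ := (inf_le_inf_left _ (BName.beq_trans _ _ _)).trans (BName.beq_trans _ _ _)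
  | rel R t =>
    exact (inf_le_inf_right _ (le_iInf fun i => ht σ τ (t i))).trans (hA _ R _ _)
  | neg φ ih =>
    simp only [sat]
    have h : (⨅ v, (σ v).beq (τ v)) ⊓ A.sat φ τ ≤ A.sat φ σ := by
      simpa only [BName.beq_comm] using ih τ σ
    rw [le_compl_iff_disjoint_right, disjoint_iff_inf_le]
    calc _ = ((⨅ v, (σ v).beq (τ v)) ⊓ A.sat φ τ) ⊓ (A.sat φ σ)ᶜ := by ac_rfl
      _ ≤ A.sat φ σ ⊓ (A.sat φ σ)ᶜ := inf_le_inf_right _ h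
      _ ≤ ⊥ := inf_compl_self _ |>.le
  | conj φ ih =>
    simp only [sat]
    exact le_iInf fun i => (inf_le_inf_left _ (iInf_le _ i)).trans (ih i σ τ)
  | disj φ ih =>
    simp only [sat]
    rw [inf_iSup_eq]
    exact iSup_mono fun i => ih i σ τ
  | all W φ ih =>
    simp only [sat]
    refine le_iInf fun ρ => (inf_le_inf_left _ (iInf_le _ ρ)).trans ?_
    rw [le_himp_iff, inf_assoc, himp_inf_self]
    exact (inf_le_inf (he W σ τ ρ) inf_le_left).trans (ih _ _)
  | ex W φ ih =>
    simp only [sat]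
    rw [inf_iSup_eq]
    refine iSup_mono fun ρ => le_inf (inf_le_right.trans inf_le_left) ?_
    exact (inf_le_inf (he W σ τ ρ) inf_le_right).trans (ih _ _)

end BStructure

/-! ## Boolean valued soundness of the sequent calculus -/

namespace BStructure

variable {B : Type w} [CompleteBooleanAlgebra B] {T : Signature.{u}} (A : BStructure B T)

/-- The sequent `Γ ⊢ Δ` holds in the Boolean valued structure `A` with Boolean value `⊤`. -/
def Valid {X : Type u} (Γ Δ : Set (Fml T X)) : Prop :=
  ∀ σ : X → BName.{u} B,
    (⨅ x, (σ x).bmem A.dom) ⊓ ⨅ φ ∈ Γ, A.sat φ σ ≤ ⨆ φ ∈ Δ, A.sat φ σ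

variable {A}

theorem iInf_bmem_dom_le_term (hconst : ∀ c, (A.const c).bmem A.dom = ⊤) {X : Type u}
    (σ : X → BName.{u} B) (t : T.Term X) :
    ⨅ x, (σ x).bmem A.dom ≤ (A.term σ t).bmem A.dom := by
  rcases t with x | c
  · exact iInf_le _ x
  · exact le_top.trans (hconst c).ge

theorem Valid.allR {X : Type u} {Γ Δ : Set (Fml T X)} {W : Type u} (φ : Fml T (X ⊕ W))
    (x : W → X) (hinj : Function.Injective x)
    (hΓ : ∀ ψ ∈ Γ, ∀ i, ¬ ψ.OccursFree (x i)) (hΔ : ∀ ψ ∈ Δ, ∀ i, ¬ ψ.OccursFree (x i))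
    (hφ : ∀ i, ¬ φ.OccursFree (Sum.inl (x i)))
    (h : A.Valid Γ (insert (φ.inst (fun i => Sum.inl (x i))) Δ)) :
    A.Valid Γ (insert (Fml.all W φ) Δ) := by
  intro σ
  rw [iSup_insert]
  simp only [sat]
  rw [iInf_sup_eq]
  refine le_iInf fun τ => ?_
  -- The side formulae `Δ` are pulled into the conclusion of the implication, and its premise, that
  -- `τ` lies in the domain, moves to the left.
  rw [himp_eq, sup_right_comm, ← himp_eq, le_himp_iff]
  have hv : ∀ ψ : Fml T X, (∀ i, ¬ ψ.OccursFree (x i)) →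
      A.sat ψ (Function.extend x τ σ) = A.sat ψ σ := by
    refine fun ψ hψ => sat_congr_of_occursFree _ _ fun v hv => Function.extend_apply' _ _ _ ?_
    rintro ⟨i, rfl⟩
    exact hψ i hv
  -- The eigenvariables `x i` are reassigned to `τ i`, consistently because `x` is injective; `Γ`,
  -- `Δ` and the parameters of `φ` do not notice.
  have h' := h (Function.extend x τ σ)
  rw [iSup_insert, sat_inst, biInf_congr fun ψ hψ => hv ψ (hΓ ψ hψ),
    biSup_congr fun ψ hψ => hv ψ (hΔ ψ hψ)] at h'
  refine le_trans ?_ (h'.trans (sup_le_sup_right (le_of_eq ?_) _))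
  · refine le_inf (le_iInf fun v => ?_) (inf_le_left.trans inf_le_right)
    by_cases hvx : ∃ i, x i = v
    · obtain ⟨i, rfl⟩ := hvx
      rw [hinj.extend_apply]
      exact inf_le_right.trans (iInf_le _ i)
    · rw [Function.extend_apply' _ _ _ hvx]
      exact inf_le_left.trans (inf_le_left.trans (iInf_le _ v))
  · refine sat_congr_of_occursFree _ _ ?_
    rintro (v | i) hv
    · refine Function.extend_apply' _ _ _ ?_
      rintro ⟨i, rfl⟩
      exact hφ i hv
    · exact hinj.extend_apply _ _ i

theorem sat_neg_all_neg {V W : Type u} (φ : Fml T (V ⊕ W)) (σ : V → BName.{u} B) :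
    A.sat (Fml.neg (Fml.all W (Fml.neg φ))) σ = A.sat (Fml.ex W φ) σ := by
  simp only [sat, compl_iInf, compl_iSup, himp_eq, compl_sup, compl_compl, inf_comm]

theorem valid_of_derivable (hA : A.RelCongr) (hconst : ∀ c, (A.const c).bmem A.dom = ⊤)
    {X : Type u} {Γ Δ : Set (Fml T X)} (h : Derivable Γ Δ) : A.Valid Γ Δ := by
  induction h with
  | ax Γ Δ φ =>
    intro σ
    rw [iInf_insert, iSup_insert]
    exact inf_le_right.trans (inf_le_left.trans le_sup_left)
  | @cut Γ Γ' Δ Δ' φ _ _ ih ih' =>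
    intro σ
    have h1 := ih σ
    have h2 := ih' σ
    rw [iInf_insert] at h1
    rw [iSup_insert] at h2
    rw [iInf_union, iSup_union]
    set m := ⨅ x, (σ x).bmem A.dom
    set G := ⨅ φ ∈ Γ, A.sat φ σ
    set G' := ⨅ φ ∈ Γ', A.sat φ σ
    calc m ⊓ (G ⊓ G') ≤ (m ⊓ G) ⊓ (m ⊓ G') := by rw [inf_inf_distrib_left]
      _ ≤ (m ⊓ G) ⊓ (A.sat φ σ ⊔ ⨆ φ ∈ Δ', A.sat φ σ) := inf_le_inf_left _ h2
      _ ≤ _ := by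
        rw [inf_sup_left]
        refine sup_le_sup ?_ inf_le_right
        exact le_trans (by rw [inf_assoc, inf_comm G]) h1
  | subst ρ _ ih =>
    intro σ
    rw [iInf_image, iSup_image]
    simp only [sat_subst]
    exact (inf_le_inf_right _ (le_iInf fun x => iInf_le _ (ρ x))).trans (ih _)
  | weak Γ' Δ' _ ih =>
    intro σ
    rw [iInf_union, iSup_union]
    exact (inf_le_inf_left _ inf_le_left).trans ((ih σ).trans le_sup_left)
  | negL _ ih =>
    intro σ
    have h := ih σ
    rw [iSup_insert, ← sdiff_le_iff, sdiff_eq] at h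
    rw [iInf_insert]
    exact le_trans (by simp only [sat]; exact le_of_eq (by ac_rfl)) h
  | negR _ ih =>
    intro σ
    have h := ih σ
    rw [iInf_insert, inf_left_comm, inf_comm, ← le_himp_iff, himp_eq, sup_comm] at h
    rw [iSup_insert]
    exact h
  | conjL φ _ ih =>
    intro σ
    have h := ih σ
    rw [iInf_union, iInf_range, inf_comm (⨅ φ ∈ _, _)] at h
    rw [iInf_insert]
    exact h
  | conjR φ _ ih =>
    intro σ
    rw [iSup_insert]
    simp only [sat]
    rw [iInf_sup_eq]
    refine le_iInf fun i => ?_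
    have h := ih i σ
    rwa [iSup_insert] at h
  | allL φ t _ ih =>
    intro σ
    have h := ih σ
    rw [iInf_insert, sat_inst] at h
    rw [iInf_insert]
    refine le_trans (le_inf inf_le_left (le_inf ?_ (inf_le_right.trans inf_le_right))) h
    simp only [sat]
    -- The quantifier is instantiated at the values of the terms `t`, which lie in the domain:
    -- variables by the guard in `Valid`, constants by `hconst`.
    refine (inf_le_inf_left _ (inf_le_left.trans (iInf_le _ (fun i => A.term σ (t i))))).trans ?_
    refine le_trans (inf_le_inf_right _ (le_iInf fun i => ?_)) inf_himp_le
    exact iInf_bmem_dom_le_term hconst σ (t i)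
  | allR φ x hinj hΓ hΔ hφ _ ih => exact Valid.allR φ x hinj hΓ hΔ hφ ih
  | eqSymm x y =>
    intro σ
    simp [sat, term, BName.beq_comm (σ x)]
  | eqSubst φ s t =>
    intro σ
    rw [iInf_insert, iInf_range, iSup_singleton, sat_inst, sat_inst]
    -- The two assignments agree on `X`, and on `W` they give the values of `t` and `s`, equal by
    -- the premises.
    refine le_trans (inf_le_right.trans ?_) (inf_sat_le_sat hA φ
      (Sum.elim σ fun i => A.term σ (t i)) _)
    rw [inf_comm]
    refine inf_le_inf_right _ ?_
    rw [iInf_sum]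
    simp [sat, BName.beq_refl, BName.beq_comm (A.term σ (t _))]
  | disjL φ =>
    intro σ
    simp [sat, compl_iInf]
  | disjR φ =>
    intro σ
    simp [sat, compl_iInf]
  | exL φ =>
    intro σ
    simp [sat_neg_all_neg]
  | exR φ =>
    intro σ
    simp [sat_neg_all_neg]

end BStructure

namespace ConsistencyProperty

variable {L : Signature.{u}} {C : Type u} (S : ConsistencyProperty L C)

/-! ## The forcing relation for membership in `Σ_F` -/

theorem condName_bmem_genericName (p : S.Cond) :
    (S.condName p).bmem S.genericName = RO.of p := by
  refine (iSup_inf_beq_check_code (equivShrink.{u} S.Cond).symm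
    (fun q => RO.of ((equivShrink S.Cond).symm q)) p).trans ?_
  simp

theorem memSigma_eq (ψ : Sentence (L.adjoin C)) :
    S.memSigma ψ = ⨆ p : {p : S.Cond // ψ ∈ p.1}, RO.of p.1 := by
  simp only [memSigma, condName_bmem_genericName]

/-- An element of `S`, as a condition. -/
def toCond {s : Set (Sentence (L.adjoin C))} (hs : s ∈ S.sets) : S.Cond := ⟨s, s, hs, subset_rfl⟩

variable {S}

theorem of_le_memSigma {p : S.Cond} {ψ : Sentence (L.adjoin C)} (h : ψ ∈ p.1) :
    RO.of p ≤ S.memSigma ψ := by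
  rw [memSigma_eq]
  exact le_iSup (fun p : {p : S.Cond // ψ ∈ p.1} => RO.of p.1) ⟨p, h⟩

/-- Some extension `r` of `p` lies below the image of a condition `q` containing `ψ`. Then `r` and
`q` are compatible, and a common extension is contained in an element of `S`. -/
theorem exists_of_le_memSigma {p : S.Cond} {ψ : Sentence (L.adjoin C)}
    (h : RO.of p ≤ S.memSigma ψ) : ∃ s ∈ S.sets, p.1 ⊆ s ∧ ψ ∈ s := by
  rw [memSigma_eq] at h
  obtain ⟨r, hrp, q, hrq⟩ := RO.exists_of_le_iSup h
  have hrq' : RO.of r ⊓ RO.of q.1 = RO.of r := inf_eq_left.2 hrq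
  obtain ⟨t, htr, htq⟩ := RO.exists_le_of_inf_ne_bot fun h => RO.of_ne_bot r (hrq'.symm.trans h)
  obtain ⟨s, hs, hts⟩ := t.2
  exact ⟨s, hs, (show p.1 ⊆ t.1 from htr.trans hrp).trans hts, hts (htq q.2)⟩

theorem top_le_of_dense {b : RO S.Cond}
    (h : ∀ s (hs : s ∈ S.sets), ∃ r ≤ S.toCond hs, RO.of r ≤ b) : b = ⊤ := by
  refine top_le_iff.1 (RO.le_of_forall_exists fun p _ => ?_)
  obtain ⟨s, hs, hps⟩ := p.2
  obtain ⟨r, hr, hrb⟩ := h s hs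
  exact ⟨r, hr.trans hps, hrb⟩

theorem memSigma_le {ψ : Sentence (L.adjoin C)} {b : RO S.Cond}
    (h : ∀ s (hs : s ∈ S.sets), ψ ∈ s → ∃ r ≤ S.toCond hs, RO.of r ≤ b) : S.memSigma ψ ≤ b := by
  refine RO.le_of_forall_exists fun p hp => ?_
  obtain ⟨s, hs, hps, hψ⟩ := exists_of_le_memSigma hp
  obtain ⟨r, hr, hrb⟩ := h s hs hψ
  exact ⟨r, hr.trans hps, hrb⟩

theorem memSigma_inf_memSigma_le {ψ χ : Sentence (L.adjoin C)} {b : RO S.Cond}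
    (h : ∀ s (hs : s ∈ S.sets), ψ ∈ s → χ ∈ s → ∃ r ≤ S.toCond hs, RO.of r ≤ b) :
    S.memSigma ψ ⊓ S.memSigma χ ≤ b := by
  refine RO.le_of_forall_exists fun p hp => ?_
  obtain ⟨s, hs, hps, hψ⟩ := exists_of_le_memSigma (hp.trans inf_le_left)
  obtain ⟨s', hs', hss', hχ⟩ := exists_of_le_memSigma (p := S.toCond hs)
    ((RO.le_of (show S.toCond hs ≤ p from hps)).trans (hp.trans inf_le_right))
  obtain ⟨r, hr, hrb⟩ := h s' hs' (hss' hψ) hχ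
  exact ⟨r, hr.trans (hps.trans hss'), hrb⟩

theorem exists_extension {s : Set (Sentence (L.adjoin C))} (hs : s ∈ S.sets)
    {ψ : Sentence (L.adjoin C)} (h : insert ψ s ∈ S.sets) :
    ∃ r ≤ S.toCond hs, RO.of r ≤ S.memSigma ψ :=
  ⟨S.toCond h, Set.subset_insert ψ s, of_le_memSigma (Set.mem_insert ψ s)⟩

theorem exists_extension_iSup {s : Set (Sentence (L.adjoin C))} (hs : s ∈ S.sets) {ι : Sort*}
    {ψ : ι → Sentence (L.adjoin C)} (h : ∃ i, insert (ψ i) s ∈ S.sets) :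
    ∃ r ≤ S.toCond hs, RO.of r ≤ ⨆ i, S.memSigma (ψ i) := by
  obtain ⟨i, hi⟩ := h
  obtain ⟨r, hr, hri⟩ := exists_extension hs hi
  exact ⟨r, hr, hri.trans (le_iSup (fun i => S.memSigma (ψ i)) i)⟩

variable (S)

/-! ### Consistency and the (Ind) clauses as inequalities of Boolean values -/

theorem memSigma_neg_le_compl (φ : Sentence (L.adjoin C)) :
    S.memSigma (Fml.neg φ) ≤ (S.memSigma φ)ᶜ := by
  rw [le_compl_iff_disjoint_left, disjoint_iff_inf_le]
  exact memSigma_inf_memSigma_le fun s hs h1 h2 => ((S.con s hs φ).elim (· h1) (· h2)).elim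

theorem memSigma_neg_le_moveNeg (φ : Sentence (L.adjoin C)) :
    S.memSigma (Fml.neg φ) ≤ S.memSigma φ.moveNeg :=
  memSigma_le fun s hs h => exists_extension hs (S.ind1 s hs φ h)

theorem memSigma_conj_le {ι : Type u} (φ : ι → Sentence (L.adjoin C)) :
    S.memSigma (Fml.conj φ) ≤ ⨅ i, S.memSigma (φ i) :=
  le_iInf fun i => memSigma_le fun s hs h => exists_extension hs (S.ind2 s hs ι φ h i)

theorem memSigma_all_le {W : Type u} (φ : Fml (L.adjoin C) (PEmpty ⊕ W)) :
    S.memSigma (Fml.all W φ) ≤ ⨅ c, S.memSigma (φ.instConst c) :=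
  le_iInf fun c => memSigma_le fun s hs h => exists_extension hs (S.ind3 s hs W φ h c)

theorem memSigma_disj_le {ι : Type u} (φ : ι → Sentence (L.adjoin C)) :
    S.memSigma (Fml.disj φ) ≤ ⨆ i, S.memSigma (φ i) :=
  memSigma_le fun s hs h => exists_extension_iSup hs (S.ind4 s hs ι φ h)

theorem memSigma_ex_le {W : Type u} (φ : Fml (L.adjoin C) (PEmpty ⊕ W)) :
    S.memSigma (Fml.ex W φ) ≤ ⨆ c, S.memSigma (φ.instConst c) := by
  refine memSigma_le fun s hs h => exists_extension_iSup hs ?_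
  obtain ⟨c, hc⟩ := S.ind5 s hs W φ h
  exact ⟨_, hc⟩

/-! ## Equality in the term model -/

theorem memSigma_eqC_comm (c d : (L.adjoin C).Const) :
    S.memSigma (eqC c d) = S.memSigma (eqC d c) :=
  le_antisymm (memSigma_le fun s hs h => exists_extension hs (S.str1 s hs c d h))
    (memSigma_le fun s hs h => exists_extension hs (S.str1 s hs d c h))

theorem memSigma_eqC_inf_instConst_le (c d : (L.adjoin C).Const)
    (φ : Fml (L.adjoin C) (PEmpty ⊕ PUnit.{u + 1})) :
    S.memSigma (eqC c d) ⊓ S.memSigma (φ.instConst (fun _ => d)) ≤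
      S.memSigma (φ.instConst (fun _ => c)) :=
  memSigma_inf_memSigma_le fun s hs h1 h2 => exists_extension hs (S.str2 s hs c d φ h1 h2)

/-- This is (Str.2) for the formula `x = e`. -/
theorem memSigma_eqC_trans (c d e : (L.adjoin C).Const) :
    S.memSigma (eqC c d) ⊓ S.memSigma (eqC d e) ≤ S.memSigma (eqC c e) :=
  S.memSigma_eqC_inf_instConst_le c d
    (Fml.eq (Sum.inl (Sum.inr PUnit.unit)) (Sum.inr e))

theorem iSup_memSigma_eqC_new (d : (L.adjoin C).Const) :
    ⨆ c : C, S.memSigma (eqC (T := L.adjoin C) (Sum.inr c) d) = ⊤ :=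
  top_le_of_dense fun s hs => exists_extension_iSup hs (S.str3 s hs d)

/-- No clause asserts reflexivity: (Str.3) supplies some `c = d`, and symmetry and transitivity then
give `d = d`. -/
theorem memSigma_eqC_self (d : (L.adjoin C).Const) : S.memSigma (eqC d d) = ⊤ := by
  rw [← top_le_iff, ← S.iSup_memSigma_eqC_new d]
  refine iSup_le fun c => ?_
  exact le_trans (le_inf (S.memSigma_eqC_comm _ _).le le_rfl)
    (S.memSigma_eqC_trans d (Sum.inr c) d)

theorem className_beq_eq (c d : (L.adjoin C).Const) :
    (S.className c).beq (S.className d) = S.memSigma (eqC c d) := by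
  have hr : ∀ (f : (L.adjoin C).Const → RO S.Cond) (a : (L.adjoin C).Const),
      ⨆ i, f i ⊓ (BName.check (code.{u} a) : BName.{u} (RO S.Cond)).beq
        (BName.check (code i)) = f a :=
    fun f a => iSup_inf_beq_check_code (Equiv.refl _) f a
  have hl : ∀ (f : (L.adjoin C).Const → RO S.Cond) (a : (L.adjoin C).Const),
      ⨆ i, f i ⊓ (BName.check (code.{u} i) : BName.{u} (RO S.Cond)).beq
        (BName.check (code a)) = f a := by
    exact fun f a => (iSup_congr fun i => by rw [BName.beq_comm]).trans (hr f a)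
  refine le_antisymm ?_ (BName.le_beq_mk_iff.2 ⟨fun e => ?_, fun e => ?_⟩)
  -- By reflexivity `d` belongs to its own class, hence to that of `c`.
  · have h := (BName.le_beq_mk_iff.1 (le_refl ((S.className c).beq (S.className d)))).2 d
    rwa [hl, memSigma_eqC_self, inf_top_eq] at h
  · rw [hr, memSigma_eqC_comm]
    exact S.memSigma_eqC_trans d c e
  · rw [hl]
    exact S.memSigma_eqC_trans c d e

/-- (Str.2) replaces the constant at a single place, so the entries of `d` are exchanged for those
of `c` one coordinate at a time. -/
theorem iInf_eqC_inf_relC_le {n : ℕ} (R : (L.adjoin C).Rel n)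
    (c d : Fin n → (L.adjoin C).Const) :
    (⨅ i, S.memSigma (eqC (c i) (d i))) ⊓ S.memSigma (relC R d) ≤ S.memSigma (relC R c) := by
  have step : ∀ (e : Fin n → (L.adjoin C).Const) (i : Fin n) (a : (L.adjoin C).Const),
      S.memSigma (eqC a (e i)) ⊓ S.memSigma (relC R e) ≤
        S.memSigma (relC R (Function.update e i a)) := by
    intro e i a
    have hφ : ∀ b, (Fml.rel R (fun j => if j = i then Sum.inl (Sum.inr PUnit.unit)
        else Sum.inr (e j)) : Fml (L.adjoin C) (PEmpty ⊕ PUnit.{u + 1})).instConst (fun _ => b) =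
          relC R (Function.update e i b) := by
      intro b
      simp only [Fml.instConst, Fml.inst, Fml.subst, relC]
      congr 1
      funext j
      by_cases hj : j = i
      · subst hj
        simp [Fml.substTerm]
      · simp [Fml.substTerm, hj]
    have h := S.memSigma_eqC_inf_instConst_le a (e i) (Fml.rel R (fun j =>
      if j = i then Sum.inl (Sum.inr PUnit.unit) else Sum.inr (e j)))
    rwa [hφ, hφ, Function.update_eq_self] at h
  have key : ∀ s : Finset (Fin n), (⨅ i, S.memSigma (eqC (c i) (d i))) ⊓ S.memSigma (relC R d) ≤
      S.memSigma (relC R (s.piecewise c d)) := by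
    intro s
    induction s using Finset.induction_on with
    | empty => rw [Finset.piecewise_empty]; exact inf_le_right
    | insert i s hi ih =>
      rw [Finset.piecewise_insert]
      refine le_trans (le_inf (inf_le_left.trans (iInf_le _ i)) ih) ?_
      have h := step (s.piecewise c d) i (c i)
      rwa [Finset.piecewise_eq_of_notMem _ _ _ hi] at h
  simpa using key Finset.univ

theorem termModel_rel {n : ℕ} (R : (L.adjoin C).Rel n) (x : Fin n → BName.{u} (RO S.Cond)) :
    S.termModel.rel R x = ⨆ c : Fin n → (L.adjoin C).Const,
      (⨅ i, (x i).beq (S.className (c i))) ⊓ S.memSigma (relC R c) :=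
  rfl

theorem termModel_rel_className {n : ℕ} (R : (L.adjoin C).Rel n)
    (c : Fin n → (L.adjoin C).Const) :
    S.termModel.rel R (fun i => S.className (c i)) = S.memSigma (relC R c) := by
  simp only [termModel_rel, className_beq_eq]
  refine le_antisymm (iSup_le fun d => S.iInf_eqC_inf_relC_le R c d) (le_iSup_of_le c ?_)
  simp [memSigma_eqC_self]

theorem termModel_dom_beq_newClasses : S.termModel.dom.beq S.newClasses = ⊤ := by
  refine top_le_iff.1 (BName.le_beq_mk_iff.2 ⟨fun d => ?_, fun c => ?_⟩)
  · refine le_top.trans ((S.iSup_memSigma_eqC_new d).ge.trans (iSup_mono fun c => ?_))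
    refine le_inf le_top (le_of_eq ?_)
    rw [BName.beq_comm]
    exact (S.className_beq_eq (Sum.inr c) d).symm
  · exact le_iSup_of_le (Sum.inr c) (le_inf le_top (le_top.trans (BName.beq_refl _).ge))

/-! ## Truth in the term model -/

theorem termModel_relCongr : S.termModel.RelCongr := by
  intro n R x y
  rw [termModel_rel, termModel_rel, inf_iSup_eq]
  refine iSup_mono fun c => ?_
  rw [← inf_assoc, ← iInf_inf_eq]
  refine inf_le_inf_right _ (iInf_mono fun i => ?_)
  rw [BName.beq_comm (x i)]
  exact BName.beq_trans _ _ _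

theorem bmem_termModel_dom (x : BName.{u} (RO S.Cond)) :
    x.bmem S.termModel.dom = ⨆ c, x.beq (S.className c) := by
  simp [termModel, BName.bmem]

theorem className_bmem_dom (c : (L.adjoin C).Const) :
    (S.className c).bmem S.termModel.dom = ⊤ := by
  rw [bmem_termModel_dom, ← top_le_iff]
  exact le_iSup_of_le c (BName.beq_refl _).ge

theorem term_className {V : Type u} (c : V → (L.adjoin C).Const) (t : (L.adjoin C).Term V) :
    S.termModel.term (fun v => S.className (c v)) t = S.className (Sum.elim c id t) := by
  cases t <;> rfl

variable [Infinite C]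

/-- Each `τ i` equals some class; finiteness of `W` allows the constants to be chosen
simultaneously, and Leibniz's law transfers satisfaction. -/
theorem iInf_bmem_dom_inf_sat_le {V W : Type u} [Finite W] (φ : Fml (L.adjoin C) (V ⊕ W))
    (σ : V → BName.{u} (RO S.Cond)) (τ : W → BName.{u} (RO S.Cond)) :
    (⨅ i, (τ i).bmem S.termModel.dom) ⊓ S.termModel.sat φ (Sum.elim σ τ) ≤
      ⨆ d : W → (L.adjoin C).Const,
        S.termModel.sat φ (Sum.elim σ (fun i => S.className (d i))) := by
  have : Nonempty (L.adjoin C).Const := ⟨Sum.inr (Classical.arbitrary C)⟩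
  simp only [bmem_termModel_dom]
  refine (inf_le_inf_right _ (iInf_iSup_le_iSup_iInf_of_finite _)).trans ?_
  rw [iSup_inf_eq]
  refine iSup_mono fun d => le_trans (inf_le_inf_right _ ?_)
    (BStructure.inf_sat_le_sat S.termModel_relCongr φ _ _)
  rw [iInf_sum]
  simp [BName.beq_refl]

theorem sat_ex_eq {V W : Type u} [Finite W] (φ : Fml (L.adjoin C) (V ⊕ W))
    (σ : V → BName.{u} (RO S.Cond)) :
    S.termModel.sat (Fml.ex W φ) σ = ⨆ d : W → (L.adjoin C).Const,
        S.termModel.sat φ (Sum.elim σ (fun i => S.className (d i))) := by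
  simp only [BStructure.sat]
  refine le_antisymm (iSup_le fun τ => S.iInf_bmem_dom_inf_sat_le φ σ τ) (iSup_le fun d => ?_)
  refine le_iSup_of_le (fun i => S.className (d i)) ?_
  simp [className_bmem_dom]

theorem sat_all_eq {V W : Type u} [Finite W] (φ : Fml (L.adjoin C) (V ⊕ W))
    (σ : V → BName.{u} (RO S.Cond)) :
    S.termModel.sat (Fml.all W φ) σ = ⨅ d : W → (L.adjoin C).Const,
        S.termModel.sat φ (Sum.elim σ (fun i => S.className (d i))) := by
  have h := S.sat_ex_eq (Fml.neg φ) σ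
  simp only [BStructure.sat] at h ⊢
  rw [← compl_inj_iff, compl_iInf, compl_iInf, ← h]
  simp only [himp_eq, compl_sup, compl_compl, inf_comm]

theorem memSigma_subst_le_sat {V : Type u} (φ : Fml (L.adjoin C) V) (hφ : φ.IsFinitary)
    (c : V → (L.adjoin C).Const) :
    S.memSigma (φ.subst (fun v => Sum.inr (c v))) ≤
        S.termModel.sat φ (fun v => S.className (c v)) ∧
      S.memSigma (Fml.neg (φ.subst (fun v => Sum.inr (c v)))) ≤
        (S.termModel.sat φ (fun v => S.className (c v)))ᶜ := by
  have he : ∀ {V W : Type u} (c : V → (L.adjoin C).Const) (d : W → (L.adjoin C).Const),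
      (Sum.elim (fun v => S.className (c v)) fun i => S.className (d i)) =
        fun v => S.className (Sum.elim c d v) := by
    intro V W c d
    funext v
    cases v <;> rfl
  have ht : ∀ {V : Type u} (c : V → (L.adjoin C).Const) (t : (L.adjoin C).Term V),
      (Fml.substTerm (fun v => Sum.inr (c v)) t : (L.adjoin C).Term PEmpty.{u + 1}) =
        Sum.inr (Sum.elim c id t) := by
    rintro V c (v | a) <;> rfl
  -- For atomic formulae membership and truth have the same value, so the negated half is just
  -- (Con).
  have hneg : ∀ (χ : Sentence (L.adjoin C)) (b : RO S.Cond), S.memSigma χ = b →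
      S.memSigma χ ≤ b ∧ S.memSigma (Fml.neg χ) ≤ bᶜ := by
    rintro χ b rfl
    exact ⟨le_rfl, S.memSigma_neg_le_compl χ⟩
  induction φ with
  | eq t s =>
    refine hneg _ _ ?_
    simp only [Fml.subst, BStructure.sat, term_className, ht]
    exact (S.className_beq_eq _ _).symm
  | rel R t =>
    refine hneg _ _ ?_
    simp only [Fml.subst, BStructure.sat, term_className, ht]
    exact (S.termModel_rel_className R _).symm
  | neg φ ih =>
    obtain ⟨h1, h2⟩ := ih hφ c
    -- The two halves swap roles: (Ind.1) turns `¬¬φ` into `φ`.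
    refine ⟨h2, (S.memSigma_neg_le_moveNeg _).trans ?_⟩
    exact h1.trans (compl_compl _).ge
  | conj φ ih =>
    refine ⟨(S.memSigma_conj_le _).trans (iInf_mono fun i => (ih i (hφ i) c).1), ?_⟩
    refine (S.memSigma_neg_le_moveNeg _).trans ((S.memSigma_disj_le _).trans ?_)
    simp only [BStructure.sat, compl_iInf]
    exact iSup_mono fun i => (ih i (hφ i) c).2
  | disj φ ih =>
    refine ⟨(S.memSigma_disj_le _).trans (iSup_mono fun i => (ih i (hφ i) c).1), ?_⟩
    refine (S.memSigma_neg_le_moveNeg _).trans ((S.memSigma_conj_le _).trans ?_)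
    simp only [BStructure.sat, compl_iSup]
    exact iInf_mono fun i => (ih i (hφ i) c).2
  | all W φ ih =>
    obtain ⟨hW, hφ⟩ := hφ
    rw [sat_all_eq, compl_iInf]
    simp only [he]
    refine ⟨(S.memSigma_all_le _).trans (iInf_mono fun d => ?_), ?_⟩
    · rw [Fml.instConst_subst_liftSubst]
      exact (ih hφ _).1
    -- (Ind.1) yields an existential with negated matrix, and (Ind.5) a witness, to which the
    -- negated half of the induction hypothesis applies.
    · refine (S.memSigma_neg_le_moveNeg _).trans ((S.memSigma_ex_le _).trans ?_)
      refine iSup_mono fun d => le_trans (le_of_eq ?_) (ih hφ (Sum.elim c d)).2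
      rw [← Fml.instConst_subst_liftSubst (V' := PEmpty)]
      rfl
  | ex W φ ih =>
    obtain ⟨hW, hφ⟩ := hφ
    rw [sat_ex_eq, compl_iSup]
    simp only [he]
    refine ⟨(S.memSigma_ex_le _).trans (iSup_mono fun d => ?_), ?_⟩
    · rw [Fml.instConst_subst_liftSubst]
      exact (ih hφ _).1
    · refine (S.memSigma_neg_le_moveNeg _).trans ((S.memSigma_all_le _).trans ?_)
      refine iInf_mono fun d => le_trans (le_of_eq ?_) (ih hφ (Sum.elim c d)).2
      rw [← Fml.instConst_subst_liftSubst (V' := PEmpty)]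
      rfl

theorem memSigma_le_satS (ψ : Sentence (L.adjoin C)) (hψ : ψ.IsFinitary) :
    S.memSigma ψ ≤ S.termModel.satS ψ := by
  have h := (S.memSigma_subst_le_sat ψ hψ PEmpty.elim).1
  rw [Fml.subst_congr ψ (τ := Sum.inl) (fun v => v.elim), Fml.subst_inl] at h
  exact h.trans_eq (congrArg (S.termModel.sat ψ) (funext fun v => v.elim))

theorem not_proves_empty (hS : S.IsFinitary) {s : Set (Sentence (L.adjoin C))}
    (hs : s ∈ S.sets) : ¬ Proves s ∅ := by
  rintro ⟨X, hX⟩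
  have h := BStructure.valid_of_derivable S.termModel_relCongr S.className_bmem_dom hX
    -- Sentences ignore the assignment, so any one with values in the domain serves.
    (fun _ => S.className (Sum.inr (Classical.arbitrary C)))
  rw [Set.image_empty, iSup_emptyset] at h
  refine RO.of_ne_bot (S.toCond hs) (le_bot_iff.1 (le_trans (le_inf (le_iInf fun _ => ?_) ?_) h))
  · exact le_top.trans (S.className_bmem_dom _).ge
  · rw [iInf_image]
    refine le_iInf₂ fun φ hφ => (of_le_memSigma (p := S.toCond hs) hφ).trans
      ((S.memSigma_le_satS φ (hS s hs φ hφ)).trans_eq ?_)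
    rw [Fml.ofSentence, BStructure.sat_subst]
    exact congrArg (S.termModel.sat φ) (funext fun v => v.elim)

end ConsistencyProperty

end InfLogic

end

theorem mainTheorem9 (L : InfLogic.Signature.{u}) (C : Type u) [Infinite C]
    (S : InfLogic.ConsistencyProperty L C) (hS : S.IsFinitary) :
    ((∀ c d : (L.adjoin C).Const,
        (S.className c).beq (S.className d) = S.memSigma (InfLogic.eqC c d)) ∧
      (∀ (n : ℕ) (R : (L.adjoin C).Rel n) (c : Fin n → (L.adjoin C).Const),
        S.termModel.rel R (fun i => S.className (c i)) = S.memSigma (InfLogic.relC R c))) ∧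
    S.termModel.dom.beq S.newClasses = ⊤ ∧
    (∀ ψ : InfLogic.Sentence (L.adjoin C), ψ.IsFinitary →
      S.memSigma ψ ⇨ S.termModel.satS ψ = ⊤) ∧
    (∀ s ∈ S.sets, ¬ InfLogic.Proves s ∅) :=
  ⟨⟨S.className_beq_eq, fun _ R c => S.termModel_rel_className R c⟩,
    S.termModel_dom_beq_newClasses,
    fun ψ hψ => himp_eq_top_iff.2 (S.memSigma_le_satS ψ hψ),
    fun _ hs => S.not_proves_empty hS hs⟩
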